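/- Consider a planar object resting on a flat frictional surface, with configuration $q_o\in\mathbb{R}^3$ (position of the centre of mass and orientation angle $\theta$), and a manipulator with configuration $q_m\in\mathbb{R}^{n_m}$, with $n_c$ pairs of potential contact points. Let $\varphi(q_o,q_m)\in\mathbb{R}^{n_c}$ be the vector of distances between these pairs, and suppose that $\varphi$ is differentiable at the configuration $(q_o^-,q_m^-)$ at the beginning of a time step of length $h>0$. Evaluate the following at $(q_o^-,q_m^-)$: $\varphi^-=\varphi(q_o^-,q_m^-)$, $J_{n,o}=\partial\varphi/\partial q_o$, $J_{n,m}=\partial\varphi/\partial q_m$; $J_{t,o}\in\mathbb{R}^{2n_c\times 3}$ and $J_{t,m}\in\mathbb{R}^{2n_c\times n_m}$, the tangential Jacobians, with two opposite rows per contact, such that $J_{t,o}\dot q_o+J_{t,m}\dot q_m$ lists the sliding velocity at each contact and its negative; $J_o=[J_{n,o};J_{t,o}]$, $J_m=[J_{n,m};J_{t,m}]$; and $A=G(\theta^-)\tilde A\,G(\theta^-)^T$, where $\tilde A\succ 0$ is symmetric (ellipsoidal limit-surface model) and $G(\theta)$, which rotates the planar part by $\theta$ and fixes the angular part, converts body-axis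 velocities to world-frame velocities. Let $\mu\in\mathbb{R}^{n_c\times n_c}$ be the diagonal matrix of the nonnegative friction coefficients, and let $E\in\mathbb{R}^{2n_c\times n_c}$ be block diagonal with blocks $[1;1]$. Let $v_d\in\mathbb{R}^{n_m}$ be the commanded manipulator velocity, $B\succ 0$ the (symmetric) relative feedback gain matrix and $c>0$ the scaling factor. Put $$M(cB)=\begin{bmatrix} J_oAJ_o^T+J_m(cB)J_m^T & \begin{bmatrix}0\\E\end{bmatrix}\\ \begin{bmatrix}\mu & -E^T\end{bmatrix} & 0\end{bmatrix},\qquad q(v)=\begin{bmatrix}J_m v\\0\end{bmatrix}.$$ The time-stepping linear complementarity problem, whose unknown $z=[\Lambda_n;\Lambda_t;\gamma]\in\mathbb{R}^{4n_c}$ consists of the normal impulses, the tangential impulses and the slack variables, is $$z\ge 0,\qquad w:=M(cB)\,z+q(h v_d)+\begin{bmatrix}\varphi^-\\0\end{bmatrix}\ge 0,\qquad z^Tw=0 .$$ **Theorem.** For every such system, all $c>0$, $B\succ0$, $h>0$ and $v_d\in\mathbb{R}^{n_m}$, and every feasible initial condition, i.e. every $(q_o^-,q_m^-)$ with $\varphi^-\ge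 0$ entrywise, the time-stepping linear complementarity problem has a solution. -/

import Mathlib

open scoped Matrix

noncomputable section

namespace QuasiStatic

/-- `IsLCPSolution M q z`: the vector `z` solves the linear complementarity problem `LCP(M, q)`,
i.e. `z ≥ 0`, `M z + q ≥ 0` (entrywise) and `zᵀ (M z + q) = 0`. -/
structure IsLCPSolution {ι : Type*} [Fintype ι] (M : Matrix ι ι ℝ) (q z : ι → ℝ) : Prop where
  nonneg : ∀ i, 0 ≤ z i
  slack_nonneg : ∀ i, 0 ≤ (M *ᵥ z + q) i
  complementary : z ⬝ᵥ (M *ᵥ z + q) = 0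

/-- The solution set of `LCP(M, q)`. -/
def lcpSol {ι : Type*} [Fintype ι] (M : Matrix ι ι ℝ) (q : ι → ℝ) : Set (ι → ℝ) :=
  {z | IsLCPSolution M q z}

/-- The planar transformation `G(θ)` from body-axis velocities `(v_x, v_y, θ')` of the object to
world-frame velocities: rotation by `θ` of the linear part, identity on the angular part. -/
def bodyToWorld (θ : ℝ) : Matrix (Fin 3) (Fin 3) ℝ :=
  !![Real.cos θ, -Real.sin θ, 0;
     Real.sin θ,  Real.cos θ, 0;
     0,           0,          1]

/-- The Jacobian matrix of `f : ℝⁿ → ℝᵐ` at `x`, with `(i, j)` entry `∂fᵢ/∂xⱼ`. -/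
def jacobianMatrix {m n : ℕ} (f : (Fin n → ℝ) → (Fin m → ℝ)) (x : Fin n → ℝ) :
    Matrix (Fin m) (Fin n) ℝ :=
  Matrix.of fun i j => fderiv ℝ f x (Pi.single j 1) i

/-- Index set of a contact force vector `f = [f_n; f_t]`: one normal component per contact, and two
opposing tangential components per contact (`0` for the `+` and `1` for the `-` direction). -/
abbrev ForceIdx (nc : ℕ) : Type := Fin nc ⊕ (Fin nc × Fin 2)

/-- Index set of the unknown `z = [f_n; f_t; γ]`, with one slack variable per contact. -/
abbrev VarIdx (nc : ℕ) : Type := ForceIdx nc ⊕ Fin nc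

/-- The block-diagonal matrix `E ∈ ℝ^{2nc × nc}` whose diagonal blocks are `e = [1; 1]`. -/
def blockE (nc : ℕ) : Matrix (Fin nc × Fin 2) (Fin nc) ℝ :=
  Matrix.of fun p j => if p.1 = j then 1 else 0

/-- From the `nc × n` matrix `D` that sends a generalized velocity to the (signed) sliding velocity
at each contact, the `2nc × n` tangential Jacobian: the rows `+Dᵢ` and `-Dᵢ` for each contact `i`,
so that the net tangential force at the contact is `fₜᵢ⁺ - fₜᵢ⁻`. -/
def splitTangent {nc n : ℕ} (D : Matrix (Fin nc) (Fin n) ℝ) :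
    Matrix (Fin nc × Fin 2) (Fin n) ℝ :=
  Matrix.of fun p j => if p.2 = 0 then D p.1 j else -D p.1 j

/-- A planar object (configuration in `ℝ³`: position of the centre of mass and orientation angle)
supported by a flat frictional surface, and a manipulator (configuration in `ℝ^nm`), with `nc` pairs
of potential contact points. -/
structure System (nm nc : ℕ) where
  /-- distances between the pairs of contact points -/
  dist : (Fin 3 → ℝ) → (Fin nm → ℝ) → (Fin nc → ℝ)
  /-- contribution of the object's velocity to the sliding velocities at the contacts -/
  slideObj : (Fin 3 → ℝ) → (Fin nm → ℝ) → Matrix (Fin nc) (Fin 3) ℝ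
  /-- contribution of the manipulator's velocity to the sliding velocities at the contacts -/
  slideManip : (Fin 3 → ℝ) → (Fin nm → ℝ) → Matrix (Fin nc) (Fin nm) ℝ
  /-- coefficients of friction at the contacts -/
  mu : Fin nc → ℝ
  mu_nonneg : ∀ i, 0 ≤ mu i
  /-- the symmetric positive definite matrix of the ellipsoidal surface friction model
  `H(F) = Fᵀ Ã F` on body-axis friction wrenches `F` -/
  limitSurface : Matrix (Fin 3) (Fin 3) ℝ
  limitSurface_posDef : limitSurface.PosDef

namespace System

variable {nm nc : ℕ} (S : System nm nc) (qo : Fin 3 → ℝ) (qm : Fin nm → ℝ)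

/-- The force-motion matrix in world coordinates, `A = G(θ) Ã G(θ)ᵀ`. -/
def forceMotion : Matrix (Fin 3) (Fin 3) ℝ :=
  bodyToWorld (qo 2) * S.limitSurface * (bodyToWorld (qo 2))ᵀ

/-- The object's contact Jacobian `J_o = [J_{n,o}; J_{t,o}]`, with `J_{n,o} = ∂φ/∂q_o`. -/
def jacObj : Matrix (ForceIdx nc) (Fin 3) ℝ :=
  Matrix.fromRows (jacobianMatrix (fun x => S.dist x qm) qo) (splitTangent (S.slideObj qo qm))

/-- The manipulator's contact Jacobian `J_m = [J_{n,m}; J_{t,m}]`, with `J_{n,m} = ∂φ/∂q_m`. -/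
def jacManip : Matrix (ForceIdx nc) (Fin nm) ℝ :=
  Matrix.fromRows (jacobianMatrix (fun y => S.dist qo y) qm) (splitTangent (S.slideManip qo qm))

/-- The matrix of the quasi-static LCP with feedback matrix `K` (to be used with `K = c B`),
```
M(K) = [ J_o A J_oᵀ + J_m K J_mᵀ   [0; E] ]
       [ [μ, -Eᵀ]                    0    ]
```
acting on `z = [f_n; f_t; γ]`. -/
def lcpMatrix (K : Matrix (Fin nm) (Fin nm) ℝ) : Matrix (VarIdx nc) (VarIdx nc) ℝ :=
  Matrix.fromBlocks
    (S.jacObj qo qm * S.forceMotion qo * (S.jacObj qo qm)ᵀ +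
      S.jacManip qo qm * K * (S.jacManip qo qm)ᵀ)
    (Matrix.fromRows 0 (blockE nc))
    (Matrix.fromCols (Matrix.diagonal S.mu) (-(blockE nc)ᵀ))
    0

/-- The vector of the quasi-static LCP, `q(v) = [J_m v; 0]`. -/
def lcpVector (v : Fin nm → ℝ) : VarIdx nc → ℝ :=
  Sum.elim (S.jacManip qo qm *ᵥ v) 0

/-- The matrix of the time-stepping LCP, in which the force components of `z` are impulses over the
time step: `M(c B)` evaluated at the configuration at the beginning of the step. -/
def timeStepMatrix (c : ℝ) (B : Matrix (Fin nm) (Fin nm) ℝ) : Matrix (VarIdx nc) (VarIdx nc) ℝ :=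
  S.lcpMatrix qo qm (c • B)

/-- The vector of the time-stepping LCP with step `h` and commanded velocity `vd`:
`q(h vd) + [φ⁻; 0]`, with the distances `φ⁻` at the beginning of the step in the normal rows. -/
def timeStepVector (h : ℝ) (vd : Fin nm → ℝ) : VarIdx nc → ℝ :=
  S.lcpVector qo qm (h • vd) + Sum.elim (Sum.elim (S.dist qo qm) 0) 0

/-- A configuration is feasible if no pair of contact points penetrates: `φ ≥ 0`. -/
def Feasible : Prop := ∀ i, 0 ≤ S.dist qo qm i

end System

end QuasiStatic

end

/-! The LCP matrix is copositive: its form is two nonnegative quadratic forms plus the friction sum,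
since the `E` blocks cancel. On a homogeneous solution the form vanishes, so positive definiteness
of `c • B` forces `J_mᵀ f = 0`. The commanded velocity then drops out of `z ⬝ᵥ q`, and `φ ≥ 0` makes
what remains nonnegative. This is the hypothesis of Lemke's theorem for copositive matrices.

That theorem, `LCP.exists_complementary`, is proved by parity instead of following a path. With an
artificial variable `t`, for generic `q` each complementary pattern gives the empty set, a segment
or a half-line. An endpoint with `t > 0` is shared by exactly two patterns, so if none had `t = 0`,
the endpoints counted over all patterns would be even in number. But then, by `eq_false_of_ray`,
only the all-`false` pattern is unbounded, with one endpoint, and the total is odd. A general `q` is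
a limit of generic ones, and finitely many closed cones contain the limit. -/

namespace LCP

/-! ### Endpoints of a polyhedron contained in a line -/

section Ratio

variable {κ : Type*}

/-- The boundary index of a half-line: moving from a nonnegative point `y` against a direction `k`
with a positive coordinate, some coordinate `j` with `k j > 0` is the first to vanish. -/
theorem exists_ratio_test [Fintype κ] {y k : κ → ℝ} (hy : 0 ≤ y) (hk : ∃ j, 0 < k j) :
    ∃ s : ℝ, ∃ j, 0 < k j ∧ (y + s • k) j = 0 ∧ 0 ≤ y + s • k := by
  classical
  obtain ⟨j, hj, hmin⟩ := Finset.exists_min_image (Finset.univ.filter fun j => 0 < k j)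
    (fun j => y j / k j) (by obtain ⟨j, hj⟩ := hk; exact ⟨j, by simpa using hj⟩)
  simp only [Finset.mem_filter, Finset.mem_univ, true_and] at hj hmin
  have hs : 0 ≤ y j / k j := div_nonneg (hy j) hj.le
  refine ⟨-(y j / k j), j, hj, ?_, fun i => ?_⟩
  · simp only [Pi.add_apply, Pi.smul_apply, smul_eq_mul]
    field_simp
    ring
  · simp only [Pi.zero_apply, Pi.add_apply, Pi.smul_apply, smul_eq_mul]
    rcases lt_or_ge 0 (k i) with hi | hi
    · have := (le_div_iff₀ hi).1 (hmin i hi)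
      linarith
    · have : 0 ≤ y i := hy i
      nlinarith

variable {V : Type*} [AddCommGroup V] [Module ℝ V]

/-- `IsFacet A q j`: the polyhedron `{y ≥ 0 | A y = q}` meets the hyperplane `y j = 0`. -/
def IsFacet (A : (κ → ℝ) →ₗ[ℝ] V) (q : V) (j : κ) : Prop :=
  ∃ y : κ → ℝ, 0 ≤ y ∧ A y = q ∧ y j = 0

variable {A : (κ → ℝ) →ₗ[ℝ] V} {q : V} {k : κ → ℝ}

/-- Two such facet points differ by a multiple of `k`. Nonnegativity of each at the other's
vanishing coordinate bounds that multiple from both sides by zero, so the points coincide and `hnd`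
identifies the indices. -/
theorem existsUnique_isFacet_pos [Fintype κ]
    (hker : ∀ v, A v = 0 → ∃ s : ℝ, s • k = v) (hk : A k = 0)
    (hnd : ∀ y, A y = q → ∀ i j, y i = 0 → y j = 0 → i = j)
    (hne : ∃ y, 0 ≤ y ∧ A y = q) (hpos : ∃ j, 0 < k j) :
    ∃! j, 0 < k j ∧ IsFacet A q j := by
  obtain ⟨y, hy, hyq⟩ := hne
  obtain ⟨s, j, hj, hj0, hs⟩ := exists_ratio_test hy hpos
  have hAs : A (y + s • k) = q := by simp [hyq, hk]
  refine ⟨j, ⟨hj, _, hs, hAs, hj0⟩, ?_⟩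
  rintro i ⟨hi, x, hx, hxq, hxi⟩
  obtain ⟨r, hr⟩ := hker (x - (y + s • k)) (by rw [map_sub, hxq, hAs, sub_self])
  have hxe : x = y + s • k + r • k := by rw [hr]; abel
  have h1 : 0 ≤ r := by
    have := hx j
    rw [hxe, Pi.add_apply, hj0] at this
    simp only [Pi.zero_apply, Pi.smul_apply, smul_eq_mul, zero_add] at this
    exact nonneg_of_mul_nonneg_left this hj
  have h2 : r ≤ 0 := by
    have h3 : 0 ≤ (y + s • k) i := hs i
    rw [hxe, Pi.add_apply, Pi.smul_apply, smul_eq_mul] at hxi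
    by_contra h
    have := mul_pos (not_le.1 h) hi
    linarith
  have hr0 : r = 0 := le_antisymm h2 h1
  exact hnd x hxq i j hxi (by rw [hxe, hr0, zero_smul, add_zero, hj0])

/-- If `k j = 0`, coordinate `j` vanishes along the whole line, and sliding to the zero of a
coordinate with `k i ≠ 0` gives two zeros. The point reached need not be nonnegative, so `hnd`
ranges over all solutions. -/
theorem ne_zero_of_isFacet (hk : A k = 0) (hk0 : k ≠ 0)
    (hnd : ∀ y, A y = q → ∀ i j, y i = 0 → y j = 0 → i = j) {j : κ}
    (hj : IsFacet A q j) : k j ≠ 0 := by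
  intro hkj
  obtain ⟨y, hy, hyq, hyj⟩ := hj
  obtain ⟨i, hi⟩ := Function.ne_iff.1 hk0
  have hi0 : k i ≠ 0 := hi
  have hz : A (y + (-(y i / k i)) • k) = q := by simp [hyq, hk]
  have := hnd _ hz i j (by simp [hi0]) (by simp [hkj, hyj])
  exact hi0 (this ▸ hkj)

-- Each sign occurring in `k` yields one endpoint; the negative case is the positive one for `-k`.
open Classical in
theorem card_isFacet [Fintype κ] (hker : ∀ v, A v = 0 → ∃ s : ℝ, s • k = v) (hk : A k = 0)
    (hk0 : k ≠ 0) (hnd : ∀ y, A y = q → ∀ i j, y i = 0 → y j = 0 → i = j)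
    (hne : ∃ y, 0 ≤ y ∧ A y = q) :
    (Finset.univ.filter fun j => IsFacet A q j).card =
      (if ∃ j, 0 < k j then 1 else 0) + (if ∃ j, k j < 0 then 1 else 0) := by
  have hsplit : (Finset.univ.filter fun j => IsFacet A q j) =
      (Finset.univ.filter fun j => 0 < k j ∧ IsFacet A q j) ∪
        (Finset.univ.filter fun j => k j < 0 ∧ IsFacet A q j) := by
    ext j
    simp only [Finset.mem_filter, Finset.mem_univ, true_and, Finset.mem_union]
    constructor
    · intro hj
      rcases lt_or_gt_of_ne (ne_zero_of_isFacet hk hk0 hnd hj) with h | h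
      · exact Or.inr ⟨h, hj⟩
      · exact Or.inl ⟨h, hj⟩
    · rintro (h | h) <;> exact h.2
  have hcard : ∀ k' : κ → ℝ, (∀ v, A v = 0 → ∃ s : ℝ, s • k' = v) → A k' = 0 →
      (Finset.univ.filter fun j => 0 < k' j ∧ IsFacet A q j).card =
        if ∃ j, 0 < k' j then 1 else 0 := by
    intro k' h1 h2
    split_ifs with h
    · obtain ⟨j, hj, huniq⟩ := existsUnique_isFacet_pos h1 h2 hnd hne h
      refine Finset.card_eq_one.2 ⟨j, ?_⟩
      ext i
      simp only [Finset.mem_filter, Finset.mem_univ, true_and, Finset.mem_singleton]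
      exact ⟨huniq i, fun e => e ▸ hj⟩
    · rw [Finset.card_eq_zero, Finset.filter_eq_empty_iff]
      exact fun j _ hj => h ⟨j, hj.1⟩
  rw [hsplit, Finset.card_union_of_disjoint, hcard k hker hk]
  · have := hcard (-k) (fun v hv => ?_) (by rw [map_neg, hk, neg_zero])
    · simpa using this
    · obtain ⟨s, hs⟩ := hker v hv
      exact ⟨-s, by simpa using hs⟩
  · rw [Finset.disjoint_filter]
    exact fun j _ h1 h2 => lt_asymm h1.1 h2.1

end Ratio

/-! ### Complementary patterns and pivoting -/

section Complementary

variable {ι : Type*}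

/-- The projection of `ℝ^ι` onto the coordinates `i` with `α i = b`. -/
def part (α : ι → Bool) (b : Bool) : (ι → ℝ) →ₗ[ℝ] (ι → ℝ) :=
  LinearMap.pi fun i => if α i = b then LinearMap.proj i else 0

theorem part_apply (α : ι → Bool) (b : Bool) (x : ι → ℝ) (i : ι) :
    part α b x i = if α i = b then x i else 0 := by
  unfold part
  split_ifs <;> simp_all

theorem part_nonneg (α : ι → Bool) (b : Bool) {x : ι → ℝ} (hx : 0 ≤ x) : 0 ≤ part α b x := by
  intro i
  rw [part_apply]
  split_ifs
  exacts [hx i, le_rfl]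

variable [Fintype ι]

theorem part_dotProduct_part (α : ι → Bool) (x y : ι → ℝ) :
    part α true x ⬝ᵥ part α false y = 0 := by
  refine Finset.sum_eq_zero fun i _ => ?_
  rw [part_apply, part_apply]
  cases α i <;> simp

/-- The linear map `x ↦ w - M z`, where `x` lists the coordinates `z i` (for `α i = true`) and `w i`
(for `α i = false`), and the complementary coordinates of `z` and `w` vanish. -/
def complMap (M : Matrix ι ι ℝ) (α : ι → Bool) : (ι → ℝ) →ₗ[ℝ] (ι → ℝ) :=
  part α false - M.mulVecLin ∘ₗ part α true

/-- The linear map `(x, t) ↦ w - M z - t 1`, the artificial variable `t` being the `none`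
coordinate. -/
def augMap (M : Matrix ι ι ℝ) (α : ι → Bool) : (Option ι → ℝ) →ₗ[ℝ] (ι → ℝ) :=
  complMap M α ∘ₗ LinearMap.funLeft ℝ ℝ some -
    (LinearMap.proj none : (Option ι → ℝ) →ₗ[ℝ] ℝ).smulRight (1 : ι → ℝ)

theorem complMap_apply (M : Matrix ι ι ℝ) (α : ι → Bool) (x : ι → ℝ) :
    complMap M α x = part α false x - M *ᵥ part α true x := rfl

theorem augMap_apply (M : Matrix ι ι ℝ) (α : ι → Bool) (y : Option ι → ℝ) :
    augMap M α y = part α false (y ∘ some) - M *ᵥ part α true (y ∘ some) - y none • 1 := rfl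

/-- `q` lies in no proper subspace spanned by columns of the augmented complementary systems. -/
structure Nondegenerate (M : Matrix ι ι ℝ) (q : ι → ℝ) : Prop where
  surjective : ∀ α y, augMap M α y = q → Function.Surjective (augMap M α)
  eq_of_zero : ∀ α y, augMap M α y = q → ∀ i j, y i = 0 → y j = 0 → i = j
  complMap_surjective : ∀ α x, complMap M α x = q → Function.Surjective (complMap M α)

theorem exists_ker_generator {M : Matrix ι ι ℝ} {α : ι → Bool}
    (h : Function.Surjective (augMap M α)) :
    ∃ k, k ≠ 0 ∧ augMap M α k = 0 ∧ ∀ v, augMap M α v = 0 → ∃ s : ℝ, s • k = v := by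
  have h1 := (augMap M α).finrank_range_add_finrank_ker
  rw [LinearMap.range_eq_top.2 h, finrank_top, Module.finrank_fintype_fun_eq_card,
    Module.finrank_fintype_fun_eq_card, Fintype.card_option] at h1
  have h2 : Module.finrank ℝ (LinearMap.ker (augMap M α)) = 1 := by omega
  obtain ⟨k, hk0, hk⟩ := finrank_eq_one_iff'.1 h2
  refine ⟨k, by simpa using hk0, k.2, fun v hv => ?_⟩
  obtain ⟨s, hs⟩ := hk ⟨v, hv⟩
  exact ⟨s, by simpa using congrArg Subtype.val hs⟩

theorem augMap_update [DecidableEq ι] {M : Matrix ι ι ℝ} {α : ι → Bool} {i : ι} {y : Option ι → ℝ}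
    (hy : y (some i) = 0) : augMap M (Function.update α i (!α i)) y = augMap M α y := by
  have : ∀ b, part (Function.update α i (!α i)) b (y ∘ some) = part α b (y ∘ some) := by
    intro b
    ext j
    rw [part_apply, part_apply]
    rcases eq_or_ne j i with rfl | hj
    · simp [hy]
    · rw [Function.update_of_ne hj]
  rw [augMap_apply, augMap_apply, this, this]

theorem isFacet_update [DecidableEq ι] {M : Matrix ι ι ℝ} {q : ι → ℝ} {α : ι → Bool} {i : ι}
    (h : IsFacet (augMap M α) q (some i)) :
    IsFacet (augMap M (Function.update α i (!α i))) q (some i) := by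
  obtain ⟨y, hy, hyq, hyi⟩ := h
  exact ⟨y, hy, by rw [augMap_update hyi, hyq], hyi⟩

-- Pivoting, that is, flipping the pattern at the vanishing index, is a fixed-point-free involution
-- on these pairs.
open Classical in
theorem even_card_isFacet_some (M : Matrix ι ι ℝ) (q : ι → ℝ) :
    Even (Finset.univ.filter
      fun p : (ι → Bool) × ι => IsFacet (augMap M p.1) q (some p.2)).card := by
  rw [← ZMod.natCast_eq_zero_iff_even, Finset.card_eq_sum_ones, Nat.cast_sum]
  refine Finset.sum_involution (fun p _ => (Function.update p.1 p.2 (!p.1 p.2), p.2))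
    (fun p _ => ?_) (fun p _ _ h => ?_) (fun p hp => ?_) (fun p _ => ?_)
  · decide
  · have := congrFun (congrArg Prod.fst h) p.2
    simp at this
  · simp only [Finset.mem_filter, Finset.mem_univ, true_and] at hp ⊢
    exact isFacet_update hp
  · simp

/-! ### Rays and the parity count -/

/-- `M` is copositive. -/
def Copositive (M : Matrix ι ι ℝ) : Prop := ∀ z : ι → ℝ, 0 ≤ z → 0 ≤ z ⬝ᵥ (M *ᵥ z)

/-- In Lemke's scheme for a copositive matrix, a ray of almost complementary solutions is the
primary ray, unless it consists of complementary solutions. -/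
theorem eq_false_of_ray {M : Matrix ι ι ℝ} {q : ι → ℝ} (hM : Copositive M)
    (hq : ∀ z, 0 ≤ z → 0 ≤ M *ᵥ z → z ⬝ᵥ (M *ᵥ z) = 0 → 0 ≤ z ⬝ᵥ q)
    {α : ι → Bool} (hα : ¬ IsFacet (augMap M α) q none)
    {k y : Option ι → ℝ} (hk : 0 ≤ k) (hk0 : k ≠ 0) (hAk : augMap M α k = 0)
    (hy : 0 ≤ y) (hAy : augMap M α y = q) (i : ι) : α i = false := by
  have hz : 0 ≤ part α true (k ∘ some) := part_nonneg _ _ fun i => hk _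
  have hz' : 0 ≤ part α true (y ∘ some) := part_nonneg _ _ fun i => hy _
  have hw : 0 ≤ part α false (k ∘ some) := part_nonneg _ _ fun i => hk _
  have e1 := part_dotProduct_part α (k ∘ some) (k ∘ some)
  have e2 := part_dotProduct_part α (k ∘ some) (y ∘ some)
  have e3 := part_dotProduct_part α (y ∘ some) (k ∘ some)
  rw [augMap_apply] at hAk hAy
  have ht : 0 ≤ k none := hk none
  have ht' : 0 < y none := by
    refine lt_of_le_of_ne (hy none) fun h => hα ⟨y, hy, by rw [augMap_apply, hAy], h.symm⟩
  generalize hzd : part α true (k ∘ some) = z at *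
  generalize hwd : part α false (k ∘ some) = w at *
  generalize part α true (y ∘ some) = z' at *
  generalize part α false (y ∘ some) = w' at *
  have hweq : w = M *ᵥ z + k none • 1 := by
    rw [sub_sub, sub_eq_zero] at hAk; exact hAk
  have hweq' : w' = M *ᵥ z' + y none • 1 + q := by rw [← hAy]; abel
  have hMz := hM z hz
  have hsum : 0 ≤ z ⬝ᵥ (1 : ι → ℝ) := by
    rw [dotProduct_one]; exact Finset.sum_nonneg fun i _ => hz i
  rw [hweq, dotProduct_add, dotProduct_smul, smul_eq_mul] at e1
  have hprod := mul_nonneg ht hsum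
  -- Complementarity `e1` is a vanishing sum of two nonnegative terms.
  have hzz : z ⬝ᵥ (M *ᵥ z) = 0 := by linarith
  have htz : k none * (z ⬝ᵥ (1 : ι → ℝ)) = 0 := by linarith
  -- If `z = 0`, then `w` is a nonzero multiple of `1`, so no index can have `w i` suppressed: this
  -- is the primary ray.
  by_cases hz0 : z ⬝ᵥ (1 : ι → ℝ) = 0
  · have hzi : z = 0 := by
      rw [dotProduct_one, Finset.sum_eq_zero_iff_of_nonneg fun i _ => hz i] at hz0
      exact funext fun i => hz0 i (Finset.mem_univ i)
    rw [hzi, Matrix.mulVec_zero, zero_add] at hweq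
    have htpos : k none ≠ 0 := by
      intro h
      rw [h, zero_smul] at hweq
      refine hk0 (funext fun o => ?_)
      cases o with
      | none => exact h
      | some j =>
        have h1 := congrFun (hzd.trans hzi) j
        have h2 := congrFun (hwd.trans hweq) j
        rw [part_apply] at h1 h2
        cases hj : α j <;> simp_all
    have h2 := congrFun (hwd.trans hweq) i
    rw [part_apply] at h2
    by_contra hi
    simp [hi, htpos.symm] at h2
  · have ht0 : k none = 0 := (mul_eq_zero.1 htz).resolve_right hz0
    rw [ht0, zero_smul, add_zero] at hweq
    have hzq := hq z hz (hweq ▸ hw) hzz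
    rw [hweq', dotProduct_add, dotProduct_add, dotProduct_smul, smul_eq_mul] at e2
    have hpos : 0 < y none * (z ⬝ᵥ (1 : ι → ℝ)) :=
      mul_pos ht' (lt_of_le_of_ne hsum (Ne.symm hz0))
    rw [hweq] at e3
    set a := z ⬝ᵥ (M *ᵥ z') with ha
    set b := z' ⬝ᵥ (M *ᵥ z') with hb
    have hneg : a < 0 := by linarith
    -- Along `z' + s • z` the form is affine in `s`, by `hzz` and `e3`; its slope `a < 0`
    -- contradicts copositivity.
    have hcop : ∀ s : ℝ, 0 ≤ s → 0 ≤ b + s * a := by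
      intro s hs
      have := hM (z' + s • z) (add_nonneg hz' (smul_nonneg hs hz))
      simp only [Matrix.mulVec_add, Matrix.mulVec_smul, dotProduct_add, add_dotProduct,
        dotProduct_smul, smul_dotProduct, smul_eq_mul, hzz, e3] at this
      linarith
    have hb0 : 0 ≤ b := by simpa using hcop 0 le_rfl
    have := hcop ((b + 1) / (-a)) (div_nonneg (by linarith) (by linarith))
    have h3 : (b + 1) / (-a) * a = -(b + 1) := by
      rw [div_neg, neg_mul, div_mul_cancel₀ _ hneg.ne]
    linarith

open Classical in
/-- Lemke's theorem for nondegenerate data: a copositive linear complementarity problem whose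
constant vector is in the dual of the cone of homogeneous solutions has a complementary solution. -/
theorem exists_complementary_of_nondegenerate {M : Matrix ι ι ℝ} {q : ι → ℝ} (hM : Copositive M)
    (hq : ∀ z, 0 ≤ z → 0 ≤ M *ᵥ z → z ⬝ᵥ (M *ᵥ z) = 0 → 0 ≤ z ⬝ᵥ q)
    (hnd : Nondegenerate M q) : ∃ α x, 0 ≤ x ∧ complMap M α x = q := by
  suffices h : ∃ α, IsFacet (augMap M α) q none by
    obtain ⟨α, y, hy, hyq, hy0⟩ := h
    refine ⟨α, y ∘ some, fun i => hy _, ?_⟩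
    rw [augMap_apply, hy0, zero_smul, sub_zero] at hyq
    exact hyq
  by_contra! hcon
  set f : (ι → Bool) → ℕ := fun α => (Finset.univ.filter fun j => IsFacet (augMap M α) q j).card
    with hf
  have hsum : Even (∑ α, f α) := by
    convert even_card_isFacet_some M q using 1
    rw [Finset.card_filter, Fintype.sum_prod_type]
    refine Finset.sum_congr rfl fun α _ => ?_
    rw [hf]
    dsimp only
    rw [Finset.card_filter, Fintype.sum_option, if_neg (hcon α), zero_add]
  have heven : ∀ α, α ≠ (fun _ => false) → Even (f α) := by
    intro α hα
    by_cases hne : ∃ y, 0 ≤ y ∧ augMap M α y = q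
    · obtain ⟨y, hy, hyq⟩ := hne
      obtain ⟨k, hk0, hk, hker⟩ := exists_ker_generator (hnd.surjective α y hyq)
      have key : ∀ k' : Option ι → ℝ, k' ≠ 0 → augMap M α k' = 0 → ∃ j, k' j < 0 := by
        intro k' h1 h2
        by_contra! h3
        exact hα (funext (eq_false_of_ray hM hq (hcon α) h3 h1 h2 hy hyq))
      rw [hf]
      dsimp only
      rw [card_isFacet hker hk hk0 (hnd.eq_of_zero α) ⟨y, hy, hyq⟩, if_pos (key k hk0 hk),
        if_pos]
      · decide
      · simpa using key (-k) (neg_ne_zero.2 hk0) (by rw [map_neg, hk, neg_zero])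
    · rw [hf]
      dsimp only
      rw [Finset.filter_false_of_mem]
      · simp
      · rintro j - ⟨y, hy, hyq, -⟩
        exact hne ⟨y, hy, hyq⟩
  have hodd : f (fun _ => false) = 1 := by
    have hp1 : ∀ x : ι → ℝ, part (fun _ => false) true x = 0 := fun x => by
      ext i; simp [part_apply]
    have hp2 : ∀ x : ι → ℝ, part (fun _ => false) false x = x := fun x => by
      ext i; simp [part_apply]
    obtain ⟨y, hy, hyq⟩ : ∃ y, 0 ≤ y ∧ augMap M (fun _ => false) y = q := by
      -- Any `t` with `q + t • 1 ≥ 0` would do.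
      refine ⟨fun o => o.elim (∑ i, |q i|) fun i => q i + ∑ j, |q j|, ?_, ?_⟩
      · intro o
        cases o with
        | none => exact Finset.sum_nonneg fun i _ => abs_nonneg _
        | some i =>
          have h1 := Finset.single_le_sum (f := fun j => |q j|) (fun j _ => abs_nonneg _)
            (Finset.mem_univ i)
          have h2 := neg_abs_le (q i)
          simp only [Pi.zero_apply, Option.elim]
          linarith
      · rw [augMap_apply, hp1, hp2]
        ext i
        simp
    obtain ⟨k₀, hk₀0, hk₀, hker₀⟩ := exists_ker_generator (hnd.surjective _ y hyq)
    have h1 : augMap M (fun _ => false) 1 = 0 := by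
      rw [augMap_apply, hp1, hp2]
      ext i
      simp
    have hker : ∀ v, augMap M (fun _ => false) v = 0 → ∃ s : ℝ, s • (1 : Option ι → ℝ) = v := by
      intro v hv
      obtain ⟨s, hs⟩ := hker₀ v hv
      obtain ⟨r, hr⟩ := hker₀ 1 h1
      have hr0 : r ≠ 0 := by
        rintro rfl
        simpa using congrFun hr none
      exact ⟨s / r, by rw [← hr, smul_smul, div_mul_cancel₀ _ hr0, hs]⟩
    rw [hf]
    dsimp only
    rw [card_isFacet hker h1 one_ne_zero (hnd.eq_of_zero _) ⟨y, hy, hyq⟩]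
    have hn : ¬ (1 : ℝ) < 0 := by norm_num
    simp [hn]
  rw [← Finset.sum_erase_add _ _ (Finset.mem_univ (fun _ => false)), hodd, Nat.even_add_one] at hsum
  exact hsum (Finset.even_sum _ fun α hα => heven α (Finset.ne_of_mem_erase hα))

/-! ### Removing nondegeneracy -/

/-- The vectors `y` with `y i = y j = 0`. -/
def zeroAt {κ : Type*} (i j : κ) : Submodule ℝ (κ → ℝ) :=
  LinearMap.ker ((LinearMap.proj i : (κ → ℝ) →ₗ[ℝ] ℝ).prod (LinearMap.proj j))

/-- Two coordinates are lost from a space of dimension only one more than the target's. -/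
theorem map_zeroAt_ne_top (M : Matrix ι ι ℝ) (α : ι → Bool) {i j : Option ι} (hij : i ≠ j) :
    (zeroAt i j).map (augMap M α) ≠ ⊤ := by
  classical
  intro htop
  have h1 := Submodule.finrank_map_le (augMap M α) (zeroAt i j)
  rw [htop, finrank_top, Module.finrank_fintype_fun_eq_card] at h1
  have h2 := ((LinearMap.proj i : (Option ι → ℝ) →ₗ[ℝ] ℝ).prod
    (LinearMap.proj j)).finrank_range_add_finrank_ker
  rw [LinearMap.range_eq_top.2, finrank_top, Module.finrank_prod, Module.finrank_self,
    Module.finrank_fintype_fun_eq_card, Fintype.card_option] at h2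
  · unfold zeroAt at h1
    omega
  · rintro ⟨a, b⟩
    refine ⟨Function.update (Function.update 0 i a) j b, ?_⟩
    simp [Function.update_of_ne hij]

/-- Failure puts `q` in one of finitely many proper subspaces, each Lebesgue-null. -/
theorem dense_nondegenerate (M : Matrix ι ι ℝ) : Dense {q | Nondegenerate M q} := by
  have key : ∀ p : Submodule ℝ (ι → ℝ), ∀ᵐ q, q ∈ p → p = ⊤ := by
    intro p
    by_cases hp : p = ⊤
    · simp [hp]
    · have h0 := MeasureTheory.Measure.addHaar_submodule MeasureTheory.volume p hp
      filter_upwards [MeasureTheory.measure_eq_zero_iff_ae_notMem.1 h0] with q hq hqp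
      exact absurd hqp hq
  refine MeasureTheory.Measure.dense_of_ae (μ := MeasureTheory.volume) ?_
  have h1 := Filter.eventually_all.2 fun α => key (LinearMap.range (augMap M α))
  have h2 := Filter.eventually_all.2 fun α => key (LinearMap.range (complMap M α))
  have h3 := Filter.eventually_all.2 fun p : (ι → Bool) × Option ι × Option ι =>
    key ((zeroAt p.2.1 p.2.2).map (augMap M p.1))
  filter_upwards [h1, h2, h3] with q h1 h2 h3
  refine ⟨fun α y hy => LinearMap.range_eq_top.1 (h1 α ⟨y, hy⟩), fun α y hy i j hi hj => ?_,
    fun α x hx => LinearMap.range_eq_top.1 (h2 α ⟨x, hx⟩)⟩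
  by_contra hij
  refine map_zeroAt_ne_top M α hij (h3 (α, i, j) ⟨y, ?_, hy⟩)
  exact LinearMap.mem_ker.2 (Prod.ext hi hj)

/-- A copositive linear complementarity problem whose constant vector is in the dual of the cone of
homogeneous solutions has a complementary solution. -/
theorem exists_complementary {M : Matrix ι ι ℝ} {q : ι → ℝ} (hM : Copositive M)
    (hq : ∀ z, 0 ≤ z → 0 ≤ M *ᵥ z → z ⬝ᵥ (M *ᵥ z) = 0 → 0 ≤ z ⬝ᵥ q) :
    ∃ α x, 0 ≤ x ∧ complMap M α x = q := by
  -- Injectivity makes each cone closed; nondegenerate data supply it through surjectivity.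
  set T : Set (ι → ℝ) := ⋃ α ∈ {α | Function.Injective (complMap M α)},
    complMap M α '' {x | 0 ≤ x} with hT
  have hclosed : IsClosed T := by
    refine Set.Finite.isClosed_biUnion (Set.toFinite _) fun α hα => ?_
    exact (LinearMap.isClosedEmbedding_of_injective (LinearMap.ker_eq_bot.2 hα)).isClosedMap _
      isClosed_Ici
  -- Perturbing `q` only upward preserves `hq`, because `z ≥ 0` there.
  have hU : IsOpen (Set.univ.pi fun i => Set.Ioi (q i)) :=
    isOpen_set_pi Set.finite_univ fun i _ => isOpen_Ioi
  have hsub : (Set.univ.pi fun i => Set.Ioi (q i)) ∩ {q | Nondegenerate M q} ⊆ T := by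
    rintro p ⟨hp, hnd⟩
    obtain ⟨α, x, hx, hxp⟩ := exists_complementary_of_nondegenerate hM (q := p)
      (fun z h1 h2 h3 => (hq z h1 h2 h3).trans
        (dotProduct_le_dotProduct_of_nonneg_left (fun i => (hp i trivial).le) h1)) hnd
    exact Set.mem_biUnion (LinearMap.injective_iff_surjective.2 (hnd.complMap_surjective α x hxp))
      ⟨x, hx, hxp⟩
  have hmem : q ∈ T := by
    refine closure_minimal hsub hclosed ?_
    refine closure_minimal ((dense_nondegenerate M).open_subset_closure_inter hU)
      isClosed_closure ?_
    rw [closure_pi_set]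
    intro i _
    exact (closure_Ioi (q i)).ge (Set.mem_Ici.2 le_rfl)
  simp only [hT, Set.mem_iUnion] at hmem
  obtain ⟨α, -, x, hx, hxq⟩ := hmem
  exact ⟨α, x, hx, hxq⟩

end Complementary

end LCP

/-! ### Application to the time-stepping problem -/

namespace QuasiStatic

theorem lcpSol_nonempty_of_copositive {ι : Type*} [Fintype ι] {M : Matrix ι ι ℝ} {q : ι → ℝ}
    (hM : LCP.Copositive M)
    (hq : ∀ z, 0 ≤ z → 0 ≤ M *ᵥ z → z ⬝ᵥ (M *ᵥ z) = 0 → 0 ≤ z ⬝ᵥ q) :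
    (lcpSol M q).Nonempty := by
  obtain ⟨α, x, hx, hxq⟩ := LCP.exists_complementary hM hq
  have hw : M *ᵥ LCP.part α true x + q = LCP.part α false x := by
    rw [← hxq, LCP.complMap_apply]; abel
  refine ⟨LCP.part α true x, LCP.part_nonneg _ _ hx, ?_, ?_⟩
  · rw [hw]
    exact LCP.part_nonneg _ _ hx
  · rw [hw]
    exact LCP.part_dotProduct_part α x x

theorem dotProduct_congruence_mulVec {m n : Type*} [Fintype m] [Fintype n]
    (J : Matrix m n ℝ) (K : Matrix n n ℝ) (f : m → ℝ) :
    f ⬝ᵥ ((J * K * Jᵀ) *ᵥ f) = (Jᵀ *ᵥ f) ⬝ᵥ (K *ᵥ (Jᵀ *ᵥ f)) := by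
  rw [← Matrix.mulVec_mulVec, ← Matrix.mulVec_mulVec, Matrix.dotProduct_mulVec,
    Matrix.mulVec_transpose J f]

namespace System

variable {nm nc : ℕ} (S : System nm nc) (qo : Fin 3 → ℝ) (qm : Fin nm → ℝ)

theorem forceMotion_quadratic_nonneg (x : Fin 3 → ℝ) : 0 ≤ x ⬝ᵥ (S.forceMotion qo *ᵥ x) := by
  rw [forceMotion, dotProduct_congruence_mulVec]
  simpa using S.limitSurface_posDef.posSemidef.dotProduct_mulVec_nonneg
    ((bodyToWorld (qo 2))ᵀ *ᵥ x)

theorem lcpMatrix_quadratic (K : Matrix (Fin nm) (Fin nm) ℝ) (z : VarIdx nc → ℝ) :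
    z ⬝ᵥ (S.lcpMatrix qo qm K *ᵥ z) =
      ((S.jacObj qo qm)ᵀ *ᵥ (z ∘ Sum.inl)) ⬝ᵥ
          (S.forceMotion qo *ᵥ ((S.jacObj qo qm)ᵀ *ᵥ (z ∘ Sum.inl))) +
        ((S.jacManip qo qm)ᵀ *ᵥ (z ∘ Sum.inl)) ⬝ᵥ
          (K *ᵥ ((S.jacManip qo qm)ᵀ *ᵥ (z ∘ Sum.inl))) +
        ∑ i, z (Sum.inr i) * (S.mu i * z (Sum.inl (Sum.inl i))) := by
  obtain ⟨f, g, rfl⟩ : ∃ f g, z = Sum.elim f g := ⟨_, _, (Sum.elim_comp_inl_inr z).symm⟩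
  obtain ⟨a, b, rfl⟩ : ∃ a b, f = Sum.elim a b := ⟨_, _, (Sum.elim_comp_inl_inr f).symm⟩
  have h1 : Sum.elim a b ⬝ᵥ (Matrix.fromRows 0 (blockE nc) *ᵥ g) = b ⬝ᵥ (blockE nc *ᵥ g) := by
    simp [Matrix.fromRows_mulVec]
  have h2 : g ⬝ᵥ (Matrix.fromCols (Matrix.diagonal S.mu) (-(blockE nc)ᵀ) *ᵥ Sum.elim a b) =
      ∑ i, g i * (S.mu i * a i) - b ⬝ᵥ (blockE nc *ᵥ g) := by
    rw [Matrix.fromCols_mulVec_sumElim, dotProduct_add, Matrix.neg_mulVec, dotProduct_neg,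
      Matrix.mulVec_transpose, dotProduct_comm g (b ᵥ* blockE nc), ← Matrix.dotProduct_mulVec,
      ← sub_eq_add_neg]
    simp [dotProduct, Matrix.mulVec_diagonal]
  rw [lcpMatrix, Matrix.fromBlocks_mulVec, sumElim_dotProduct_sumElim, dotProduct_add,
    dotProduct_add, Sum.elim_comp_inl, Sum.elim_comp_inr, h1, h2, Matrix.zero_mulVec,
    dotProduct_zero, Matrix.add_mulVec, dotProduct_add, dotProduct_congruence_mulVec,
    dotProduct_congruence_mulVec]
  simp only [Sum.elim_inl, Sum.elim_inr]
  ring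

end System

end QuasiStatic

theorem mainTheorem2 {nm nc : ℕ} (S : QuasiStatic.System nm nc)
    (qo : Fin 3 → ℝ) (qm : Fin nm → ℝ)
    (hdiff : DifferentiableAt ℝ (fun p : (Fin 3 → ℝ) × (Fin nm → ℝ) => S.dist p.1 p.2) (qo, qm))
    (hfeas : S.Feasible qo qm)
    (c : ℝ) (hc : 0 < c) (B : Matrix (Fin nm) (Fin nm) ℝ) (hB : B.PosDef)
    (h : ℝ) (hh : 0 < h) (vd : Fin nm → ℝ) :
    (QuasiStatic.lcpSol (S.timeStepMatrix qo qm c B) (S.timeStepVector qo qm h vd)).Nonempty := by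
  have hcB : (c • B).PosDef := hB.smul hc
  have hfric : ∀ z : QuasiStatic.VarIdx nc → ℝ, 0 ≤ z →
      0 ≤ ∑ i, z (Sum.inr i) * (S.mu i * z (Sum.inl (Sum.inl i))) := fun z hz =>
    Finset.sum_nonneg fun i _ => mul_nonneg (hz _) (mul_nonneg (S.mu_nonneg i) (hz _))
  have hK : ∀ x : Fin nm → ℝ, 0 ≤ x ⬝ᵥ ((c • B) *ᵥ x) := fun x => by
    simpa using hcB.posSemidef.dotProduct_mulVec_nonneg x
  refine QuasiStatic.lcpSol_nonempty_of_copositive (fun z hz => ?_) fun z hz _ hzz => ?_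
  · rw [QuasiStatic.System.timeStepMatrix, S.lcpMatrix_quadratic]
    exact add_nonneg (add_nonneg (S.forceMotion_quadratic_nonneg _ _) (hK _)) (hfric z hz)
  · rw [QuasiStatic.System.timeStepMatrix, S.lcpMatrix_quadratic] at hzz
    have h1 := S.forceMotion_quadratic_nonneg qo ((S.jacObj qo qm)ᵀ *ᵥ (z ∘ Sum.inl))
    have h2 := hK ((S.jacManip qo qm)ᵀ *ᵥ (z ∘ Sum.inl))
    have h3 := hfric z hz
    have hJ : (S.jacManip qo qm)ᵀ *ᵥ (z ∘ Sum.inl) = 0 := by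
      by_contra hne
      have := hcB.dotProduct_mulVec_pos hne
      simp only [star_trivial] at this
      linarith
    -- The product equals `(J_mᵀ f) ⬝ᵥ (h • vd)`, which `hJ` annihilates.
    have hq1 : z ⬝ᵥ S.lcpVector qo qm (h • vd) = 0 := by
      rw [QuasiStatic.System.lcpVector, ← Sum.elim_comp_inl_inr z,
        sumElim_dotProduct_sumElim, Matrix.dotProduct_mulVec, ← Matrix.mulVec_transpose, hJ]
      simp
    rw [QuasiStatic.System.timeStepVector, dotProduct_add, hq1, zero_add]
    refine Finset.sum_nonneg fun i _ => mul_nonneg (hz i) ?_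
    rcases i with (i | i) | i
    exacts [hfeas i, le_rfl, le_rfl]
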